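/- **Setting.** Let $\mathbb{D}$ be the open unit disc. A *Blaschke product* is a function on $\mathbb{D}$ of the form $$B(z)=\lambda z^{m}\prod_{n}\frac{|\alpha_n|}{\alpha_n}\,\frac{\alpha_n-z}{1-\overline{\alpha_n}z},$$ with $|\lambda|=1$, $m\ge 0$ an integer, and $(\alpha_n)$ a finite (possibly empty) or infinite sequence in $\mathbb{D}\setminus\{0\}$ with $\sum_n(1-|\alpha_n|)<\infty$. For a function $u$ on $\mathbb{D}$ and $\theta\in\mathbb{R}$ put $\Omega_{u,\theta}=\{z\in\mathbb{D}: |u(z)|<\theta\}$. We say that $u$ has *Property $\mathfrak{B}$* if for every $\theta\in(0,1)$ the closure of each connected component of $\Omega_{u,\theta}$ is contained in $\mathbb{D}$, and *strong Property $\mathfrak{B}$* if moreover there is $\eta\in(0,1)$ with $\delta_{u,\eta}<1$, where $\delta_{u,\eta}$ is the supremum of the pseudo-hyperbolic distances $\left|\frac{z_1-z_2}{1-\overline{z_1}z_2}\right|$ over all pairs $z_1,z_2$ in the same component of $\Omega_{u,\eta}$ (and $\delta_{u,\eta}=0$ if there is no such pair). Fix a field $\mathbb{F}$. A *persistence module*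 $\mathbb{V}$ is a family of $\mathbb{F}$-vector spaces $(V_t)_{t\in\mathbb{R}}$ with linear maps $\pi_{s,t}:V_s\to V_t$ for $s\le t$ such that $\pi_{t,t}=\mathrm{id}$, $\pi_{t,r}\circ\pi_{s,t}=\pi_{s,r}$ for $s\le t\le r$, and $V_s=0$ for all sufficiently negative $s$; morphisms are families of linear maps commuting with the $\pi_{s,t}$, and $\mathbb{V}[\Delta]$ denotes the shifted module with $\mathbb{V}[\Delta]_t=V_{t+\Delta}$. For $\Delta>0$, $\mathbb{V}$ and $\mathbb{W}$ are *$\Delta$-interleaved* if there are morphisms $F:\mathbb{V}\to\mathbb{W}[\Delta]$ and $G:\mathbb{W}\to\mathbb{V}[\Delta]$ with $G_{t+\Delta}\circ F_t=\pi^{\mathbb{V}}_{t,t+2\Delta}$ and $F_{t+\Delta}\circ G_t=\pi^{\mathbb{W}}_{t,t+2\Delta}$ for all $t$. The *interleaving distance* $d_{int}(\mathbb{V},\mathbb{W})\in[0,\infty]$ is the infimum of all $\Delta>0$ for which they are $\Delta$-interleaved ($\infty$ if there are none). A Blaschke product $B$ induces the persistence module $\mathbb{B}$ given for $t>0$ by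 the singular homology $\bigoplus_{k\ge0}H_k(\Sigma_{B,t};\mathbb{F})$ of $\Sigma_{B,t}=\Omega_{B,\theta(t)}$, where $\theta(t)=\frac{e^t-1}{e^t+1}$, i.e. $t=\ln\frac{1+\theta}{1-\theta}$, and by $0$ for $t\le 0$; the maps are induced by the inclusions. Let $\widetilde{\mathbb{B}}$ denote in the same way the module induced by $\widetilde B$, and let $\|f\|_\infty=\sup_{z\in\mathbb{D}}|f(z)|$. **Theorem B.** Let $B$ be a Blaschke product with strong Property $\mathfrak{B}$. Then for every $\varepsilon>0$ there is $\eta\in(0,1)$ such that for every Blaschke product $\widetilde B$ with strong Property $\mathfrak{B}$, $\|\widetilde B-B\|_\infty<\eta$ implies $d_{int}(\mathbb{B},\widetilde{\mathbb{B}})<\varepsilon$. -/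

import Mathlib

universe v

noncomputable section

/-! ## Persistence modules and the interleaving distance -/

/-- A persistence module over a field `F`: vector spaces `V t`, `t ∈ ℝ`, with transition maps
`V s → V t` for `s ≤ t` which are functorial, and with `V s = 0` for all sufficiently
negative `s`. -/
structure PersistenceModule (F : Type v) [Field F] where
  /-- the vector space at time `t` -/
  V : ℝ → ModuleCat.{v} F
  /-- the transition maps -/
  π : ∀ {s t : ℝ}, s ≤ t → (V s →ₗ[F] V t)
  π_refl : ∀ t : ℝ, π (le_refl t) = LinearMap.id
  π_comp : ∀ {r s t : ℝ} (hrs : r ≤ s) (hst : s ≤ t), π hst ∘ₗ π hrs = π (hrs.trans hst)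
  eventually_zero : ∃ s₀ : ℝ, ∀ s ≤ s₀, Subsingleton (V s)

namespace PersistenceModule

variable {F : Type v} [Field F]

/-- Morphisms of persistence modules: families of linear maps commuting with the transition
maps. -/
structure Hom (V W : PersistenceModule F) where
  /-- the linear map at time `t` -/
  app : ∀ t : ℝ, V.V t →ₗ[F] W.V t
  naturality : ∀ {s t : ℝ} (h : s ≤ t), app t ∘ₗ V.π h = W.π h ∘ₗ app s

/-- The `Δ`-shift `V[Δ]`, with `V[Δ]_t = V_{t + Δ}`. -/
def shift (V : PersistenceModule F) (Δ : ℝ) : PersistenceModule F where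
  V t := V.V (t + Δ)
  π h := V.π (by linarith)
  π_refl t := V.π_refl (t + Δ)
  π_comp _ _ := V.π_comp _ _
  eventually_zero := by
    obtain ⟨s₀, h⟩ := V.eventually_zero
    exact ⟨s₀ - Δ, fun s hs => h _ (by linarith)⟩

/-- For `Δ > 0`, `V` and `W` are `Δ`-interleaved if there are morphisms `f : V → W[Δ]` and
`g : W → V[Δ]` such that `g[Δ] ∘ f` and `f[Δ] ∘ g` are the `2Δ`-shift morphisms of `V` and of `W`,
that is, at each time `t` they are the transition maps from `t` to `t + 2Δ = (t + Δ) + Δ`. -/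
def Interleaved (V W : PersistenceModule F) (Δ : ℝ) : Prop :=
  ∃ hΔ : 0 < Δ, ∃ (f : Hom V (W.shift Δ)) (g : Hom W (V.shift Δ)),
    (∀ t : ℝ, g.app (t + Δ) ∘ₗ f.app t = V.π (show t ≤ t + Δ + Δ by linarith)) ∧
    (∀ t : ℝ, f.app (t + Δ) ∘ₗ g.app t = W.π (show t ≤ t + Δ + Δ by linarith))

/-- The interleaving distance: the infimum of all `Δ > 0` such that `V` and `W` are
`Δ`-interleaved (`∞` if there is no such `Δ`). -/
def interleavingDist (V W : PersistenceModule F) : ENNReal :=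
  ⨅ (Δ : ℝ) (_ : Interleaved V W Δ), ENNReal.ofReal Δ

end PersistenceModule

/-! ## Singular homology of subspaces of the plane -/

/-- The singular homology group `H_k(X; F)` of a subspace `X` of the plane. -/
def subspaceHomology (F : Type v) [Field F] (k : ℕ) (X : Set ℂ) : ModuleCat.{v} F :=
  ((AlgebraicTopology.singularHomologyFunctor (ModuleCat.{v} F) k).obj
    (ModuleCat.of F F)).obj (TopCat.of X)

/-- The map `H_k(X; F) → H_k(Y; F)` induced by an inclusion `X ⊆ Y`. -/
def subspaceHomologyMap (F : Type v) [Field F] (k : ℕ) {X Y : Set ℂ} (h : X ⊆ Y) :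
    subspaceHomology F k X →ₗ[F] subspaceHomology F k Y :=
  (((AlgebraicTopology.singularHomologyFunctor (ModuleCat.{v} F) k).obj
    (ModuleCat.of F F)).map (TopCat.ofHom (ContinuousMap.inclusion h))).hom

theorem subspaceHomologyMap_refl (F : Type v) [Field F] (k : ℕ) (X : Set ℂ) :
    subspaceHomologyMap F k (le_refl X) = LinearMap.id := by
  have h : TopCat.ofHom (ContinuousMap.inclusion (le_refl X)) =
      CategoryTheory.CategoryStruct.id (TopCat.of X) := rfl
  unfold subspaceHomologyMap
  rw [h, CategoryTheory.Functor.map_id]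
  rfl

theorem subspaceHomologyMap_comp (F : Type v) [Field F] (k : ℕ) {X Y Z : Set ℂ}
    (hXY : X ⊆ Y) (hYZ : Y ⊆ Z) :
    subspaceHomologyMap F k hYZ ∘ₗ subspaceHomologyMap F k hXY =
      subspaceHomologyMap F k (hXY.trans hYZ) := by
  have h : TopCat.ofHom (ContinuousMap.inclusion (hXY.trans hYZ)) =
      CategoryTheory.CategoryStruct.comp (TopCat.ofHom (ContinuousMap.inclusion hXY))
        (TopCat.ofHom (ContinuousMap.inclusion hYZ)) := rfl
  unfold subspaceHomologyMap
  rw [h, CategoryTheory.Functor.map_comp]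
  rfl

theorem subsingleton_subspaceHomology_empty (F : Type v) [Field F] (k : ℕ) :
    Subsingleton (subspaceHomology F k ∅) := by
  apply ModuleCat.subsingleton_of_isZero
  rcases eq_or_ne k 0 with rfl | hk
  · have e := AlgebraicTopology.singularHomologyFunctorZeroOfTotallyDisconnectedSpace
      (ModuleCat.{v} F) (ModuleCat.of F F) (TopCat.of (∅ : Set ℂ))
    refine CategoryTheory.Limits.IsZero.of_iso ?_ e
    rw [CategoryTheory.Limits.IsZero.iff_id_eq_zero]
    apply CategoryTheory.Limits.Sigma.hom_ext
    intro b
    exact (Set.notMem_empty _ b.2).elim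
  · exact AlgebraicTopology.isZero_singularHomologyFunctor_of_totallyDisconnectedSpace
      (ModuleCat.{v} F) k (ModuleCat.of F F) (TopCat.of (∅ : Set ℂ)) hk

/-- The total singular homology `H_*(X; F) = ⨁ₖ H_k(X; F)` of a subspace `X` of the plane. -/
def totalHomology (F : Type v) [Field F] (X : Set ℂ) : ModuleCat.{v} F :=
  ModuleCat.of F (DirectSum ℕ fun k => subspaceHomology F k X)

/-- The map `H_*(X; F) → H_*(Y; F)` induced by an inclusion `X ⊆ Y`. -/
def totalHomologyMap (F : Type v) [Field F] {X Y : Set ℂ} (h : X ⊆ Y) :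
    totalHomology F X →ₗ[F] totalHomology F Y :=
  DirectSum.lmap fun k => subspaceHomologyMap F k h

theorem totalHomologyMap_refl (F : Type v) [Field F] (X : Set ℂ) :
    totalHomologyMap F (le_refl X) = LinearMap.id := by
  simp only [totalHomologyMap, subspaceHomologyMap_refl]
  exact DirectSum.lmap_id

theorem totalHomologyMap_comp (F : Type v) [Field F] {X Y Z : Set ℂ}
    (hXY : X ⊆ Y) (hYZ : Y ⊆ Z) :
    totalHomologyMap F hYZ ∘ₗ totalHomologyMap F hXY = totalHomologyMap F (hXY.trans hYZ) := by
  simp only [totalHomologyMap, ← subspaceHomologyMap_comp F _ hXY hYZ]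
  exact (DirectSum.lmap_comp _ _).symm

/-! ## The persistence module induced by a function on the disc -/

/-- The level set `Ω_{u,θ} = {z ∈ 𝔻 : |u z| < θ}`. -/
def levelSet (u : ℂ → ℂ) (θ : ℝ) : Set ℂ := {z | z ∈ Metric.ball (0 : ℂ) 1 ∧ ‖u z‖ < θ}

/-- The change of variable `θ(t) = (eᵗ - 1) / (eᵗ + 1)`, the inverse of
`t(θ) = log ((1 + θ) / (1 - θ))`. -/
def thetaOf (t : ℝ) : ℝ := (Real.exp t - 1) / (Real.exp t + 1)

theorem thetaOf_mono {s t : ℝ} (h : s ≤ t) : thetaOf s ≤ thetaOf t := by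
  unfold thetaOf
  have hs := Real.exp_pos s
  have ht := Real.exp_pos t
  have := Real.exp_le_exp.2 h
  rw [div_le_div_iff₀ (by linarith) (by linarith)]
  nlinarith

theorem thetaOf_nonpos {t : ℝ} (h : t ≤ 0) : thetaOf t ≤ 0 :=
  div_nonpos_of_nonpos_of_nonneg (by linarith [Real.exp_le_one_iff.2 h])
    (by linarith [Real.exp_pos t])

theorem levelSet_thetaOf_mono (u : ℂ → ℂ) {s t : ℝ} (h : s ≤ t) :
    levelSet u (thetaOf s) ⊆ levelSet u (thetaOf t) :=
  fun _ hz => ⟨hz.1, hz.2.trans_le (thetaOf_mono h)⟩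

theorem levelSet_thetaOf_eq_empty (u : ℂ → ℂ) {t : ℝ} (h : t ≤ 0) :
    levelSet u (thetaOf t) = ∅ :=
  Set.eq_empty_of_forall_notMem fun z hz =>
    absurd (hz.2.trans_le (thetaOf_nonpos h)) (not_lt.2 (norm_nonneg (u z)))

/-- The persistence module induced by the level sets of `u`: for `t > 0` it is the homology of
`Σ_{u,t} = Ω_{u,θ(t)}`, with the maps induced by the inclusions. For `t ≤ 0` the level set is
empty, so that the module is zero there. -/
def inducedModule (F : Type v) [Field F] (u : ℂ → ℂ) : PersistenceModule F where
  V t := totalHomology F (levelSet u (thetaOf t))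
  π h := totalHomologyMap F (levelSet_thetaOf_mono u h)
  π_refl _ := totalHomologyMap_refl F _
  π_comp _ _ := totalHomologyMap_comp F _ _
  eventually_zero := by
    refine ⟨0, fun s hs => ?_⟩
    rw [levelSet_thetaOf_eq_empty u hs]
    have := subsingleton_subspaceHomology_empty F
    exact inferInstanceAs (Subsingleton (DirectSum ℕ fun k => subspaceHomology F k ∅))

/-! ## Blaschke products and the strong Property 𝔅 -/

/-- The restriction of `B` to the unit disc is a (finite or infinite) Blaschke product
`B(z) = c zᵐ ∏ₙ (|αₙ| / αₙ) (αₙ - z) / (1 - conj αₙ z)` with `|c| = 1`, the `αₙ` being points of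
`𝔻 ∖ {0}`, repeated according to multiplicity, with `∑ₙ (1 - |αₙ|) < ∞`. They are indexed by a set
of natural numbers, which may be finite or empty. -/
def IsBlaschkeProduct (B : ℂ → ℂ) : Prop :=
  ∃ (c : ℂ) (m : ℕ) (I : Set ℕ) (α : I → ℂ),
    ‖c‖ = 1 ∧ (∀ n, α n ≠ 0 ∧ ‖α n‖ < 1) ∧ Summable (fun n => 1 - ‖α n‖) ∧
    ∀ z ∈ Metric.ball (0 : ℂ) 1, ∃ P : ℂ,
      HasProd (fun n => ((‖α n‖ : ℂ) / α n) * ((α n - z) / (1 - starRingEnd ℂ (α n) * z))) P ∧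
      B z = c * z ^ m * P

/-- Property 𝔅: for every `θ ∈ (0, 1)` the closure of each component of the level set `Ω_{u,θ}` is
contained in the open unit disc. -/
def PropertyB (u : ℂ → ℂ) : Prop :=
  ∀ θ : ℝ, 0 < θ → θ < 1 → ∀ z ∈ levelSet u θ,
    closure (connectedComponentIn (levelSet u θ) z) ⊆ Metric.ball (0 : ℂ) 1

/-- The pseudo-hyperbolic distance. -/
def pseudoHyperbolicDist (z w : ℂ) : ℝ := ‖(z - w) / (1 - starRingEnd ℂ z * w)‖

/-- `δ_{u,η}`: the supremum of the pseudo-hyperbolic distances of two points of the same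
component of `Ω_{u,η}` (`0` if the level set is empty). -/
def deltaOf (u : ℂ → ℂ) (η : ℝ) : ℝ :=
  sSup {r | ∃ z ∈ levelSet u η, ∃ w ∈ connectedComponentIn (levelSet u η) z,
    r = pseudoHyperbolicDist z w}

/-- Strong Property 𝔅: Property 𝔅, and `δ_{u,η} < 1` for some `η ∈ (0, 1)`. -/
def StrongPropertyB (u : ℂ → ℂ) : Prop :=
  PropertyB u ∧ ∃ η : ℝ, 0 < η ∧ η < 1 ∧ deltaOf u η < 1

/-- The supremum norm on the unit disc (`∞` for an unbounded function). -/
def supNormDisc (f : ℂ → ℂ) : ENNReal := ⨆ z ∈ Metric.ball (0 : ℂ) 1, ‖f z‖ₑ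

end

/-!
Write `u = -log |B|` and `u₁ = -log |B₁|`. Both are nonnegative superharmonic functions on the
disc. The theorem holds because uniform closeness of `B₁` to `B` on the level set `{|B| ≤ ρ}`
propagates *multiplicatively* to the rest of the disc: if `u₁ ≥ (1 - s) u` on `{|B| = ρ}`, then
`u₁ ≥ (1 - s) u` on all of `{|B| ≥ ρ}`. Near the unit circle, where an additive bound on `B₁ - B`
says nothing about the levels close to `1`, this is exactly what is needed.

The propagation is a maximum principle, carried by `IsBlaschkeProduct.norm_pow_succ_le`. It uses
that `B` is a Blaschke product, and not merely an inner function: `u` is the increasing limit of the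
corresponding functions `u_S` of finite subproducts `Q S` of `B`
(`IsBlaschkeProduct.exists_finite_products`), and each `u_S` tends to `0` at the unit circle. With
`1 - s = n / (n + 1)` the quotient `B₁ ^ (n + 1) / (Q S) ^ n` is holomorphic on `{|B| > ρ}`,
has modulus at most one on `{|B| = ρ}`, since `|Q S| ≥ |B|`, and has upper limit at most one at the
circle. Hence it is bounded by one, and one lets `S` exhaust the factors of `B`.

In the variable `t`, where `θ(t) = tanh (t / 2)`, the passage from `|B|` to `|B| ^ (n / (n + 1))`
costs an arbitrarily small *uniform* shift `Δ`, for `n` large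
(`exists_forall_thetaOf_pow_le`). Therefore `Ω_{B, θ(t)} ⊆ Ω_{B₁, θ(t + Δ)}` for all `t`, and
likewise with `B` and `B₁` exchanged, and the maps induced by these inclusions form
a `Δ`-interleaving. So no information about the components of the level sets, or about their
homology, enters.
-/

noncomputable section

open Filter Topology Metric

/-! ### Interleavings from inclusions of level sets -/

theorem interleaved_inducedModule_of_levelSet_subset (F : Type*) [Field F] {u w : ℂ → ℂ} {Δ : ℝ}
    (hΔ : 0 < Δ)
    (huw : ∀ t, levelSet u (thetaOf t) ⊆ levelSet w (thetaOf (t + Δ)))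
    (hwu : ∀ t, levelSet w (thetaOf t) ⊆ levelSet u (thetaOf (t + Δ))) :
    (inducedModule F u).Interleaved (inducedModule F w) Δ := by
  refine ⟨hΔ, ⟨fun t => totalHomologyMap F (huw t), ?_⟩, ⟨fun t => totalHomologyMap F (hwu t), ?_⟩,
    fun t => totalHomologyMap_comp F _ _, fun t => totalHomologyMap_comp F _ _⟩
  · intro s t h
    exact (totalHomologyMap_comp F _ _).trans (totalHomologyMap_comp F _ _).symm
  · intro s t h
    exact (totalHomologyMap_comp F _ _).trans (totalHomologyMap_comp F _ _).symm

/-! ### The change of variable -/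

theorem thetaOf_pos {t : ℝ} (h : 0 < t) : 0 < thetaOf t :=
  div_pos (by linarith [Real.add_one_lt_exp h.ne']) (by linarith [Real.exp_pos t])

theorem thetaOf_lt_one (t : ℝ) : thetaOf t < 1 := by
  unfold thetaOf
  rw [div_lt_one (by linarith [Real.exp_pos t])]
  linarith

theorem thetaOf_strictMono : StrictMono thetaOf := by
  intro s t h
  unfold thetaOf
  have hs := Real.exp_pos s
  have ht := Real.exp_pos t
  have := Real.exp_lt_exp.2 h
  rw [div_lt_div_iff₀ (by linarith) (by linarith)]
  nlinarith

/-- The addition formula of the hyperbolic tangent. -/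
theorem thetaOf_add (s t : ℝ) :
    thetaOf (s + t) = (thetaOf s + thetaOf t) / (1 + thetaOf s * thetaOf t) := by
  have hs := Real.exp_pos s
  have ht := Real.exp_pos t
  have h1 : Real.exp s + 1 ≠ 0 := by positivity
  have h2 : Real.exp t + 1 ≠ 0 := by positivity
  have h3 : Real.exp s * Real.exp t + 1 ≠ 0 := by positivity
  have h4 : 1 + thetaOf s * thetaOf t =
      2 * (Real.exp s * Real.exp t + 1) / ((Real.exp s + 1) * (Real.exp t + 1)) := by
    unfold thetaOf
    field_simp
    ring
  rw [h4]
  unfold thetaOf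
  rw [Real.exp_add]
  field_simp
  ring

/-- Raising a level to the power `n / (n + 1)` is dominated by a given shift `Δ` of the
parameter, uniformly over all levels, as soon as `n` is large. -/
theorem exists_forall_thetaOf_pow_le {Δ : ℝ} (hΔ : 0 < Δ) :
    ∃ n : ℕ, n ≠ 0 ∧ ∀ t, 0 < t → thetaOf t ^ n ≤ thetaOf (t + Δ) ^ (n + 1) := by
  have hd := thetaOf_pos hΔ
  have hd1 := thetaOf_lt_one Δ
  obtain ⟨n, hn⟩ := exists_nat_gt (1 / thetaOf Δ)
  rw [div_lt_iff₀ hd] at hn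
  refine ⟨n, ?_, fun t ht => ?_⟩
  · rintro rfl
    norm_num at hn
  have ha := thetaOf_pos ht
  have ha1 := thetaOf_lt_one t
  have hadd := thetaOf_add t Δ
  set a := thetaOf t
  set d := thetaOf Δ
  set b := thetaOf (t + Δ)
  have hden : 0 < 1 + a * d := by positivity
  have hb : 0 < b := hadd ▸ by positivity
  have hba : b - a = d * (1 - a) * (1 + a) / (1 + a * d) := by
    rw [hadd]; field_simp; ring
  have hb1 : 1 - b = (1 - a) * (1 - d) / (1 + a * d) := by
    rw [hadd]; field_simp; ring
  have hba0 : 0 ≤ b - a := by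
    rw [hba]
    have : 0 ≤ 1 - a := by linarith
    positivity
  have hkey : 1 - b ≤ n * (b - a) := by
    rw [hba, hb1, ← mul_div_assoc]
    have h1 : 1 - d ≤ n * d * (1 + a) := by nlinarith [mul_pos (by linarith : 0 < n * d) ha]
    exact div_le_div_of_nonneg_right (by nlinarith) hden.le
  -- Bernoulli's inequality for `b / a = 1 + (b - a) / a`
  have hbern := one_add_mul_le_pow (show (-2 : ℝ) ≤ (b - a) / a by
    have : 0 ≤ (b - a) / a := by positivity
    linarith) n
  have hq : 1 + (b - a) / a = b / a := by field_simp; ring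
  rw [hq, div_pow] at hbern
  have h1 : 1 / b ≤ 1 + n * ((b - a) / a) := by
    have h2 : 1 / b - 1 ≤ n * (b - a) / a := by
      have h3 : 1 / b - 1 = (1 - b) / b := by field_simp
      rw [h3]
      have h4 : 0 ≤ n * (b - a) := by positivity
      exact (div_le_div_of_nonneg_right hkey hb.le).trans
        (div_le_div_of_nonneg_left h4 ha (by linarith))
    rw [mul_div_assoc] at h2
    linarith
  have h5 := h1.trans hbern
  rw [div_le_div_iff₀ hb (by positivity)] at h5
  rw [pow_succ]
  linarith

/-! ### Blaschke factors -/

/-- The Blaschke factor with zero `a`, normalized to be positive at `0`. -/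
def blaschkeFactor (a z : ℂ) : ℂ :=
  ((‖a‖ : ℂ) / a) * ((a - z) / (1 - starRingEnd ℂ a * z))

theorem one_sub_conj_mul_ne_zero {a z : ℂ} (ha : ‖a‖ < 1) (hz : ‖z‖ ≤ 1) :
    1 - starRingEnd ℂ a * z ≠ 0 := by
  intro h
  have h1 : ‖starRingEnd ℂ a * z‖ = 1 := by rw [← sub_eq_zero.1 h, norm_one]
  rw [norm_mul, RCLike.norm_conj] at h1
  nlinarith [norm_nonneg a, norm_nonneg z]

theorem norm_one_sub_conj_mul_sq_sub (a z : ℂ) :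
    ‖1 - starRingEnd ℂ a * z‖ ^ 2 - ‖a - z‖ ^ 2 = (1 - ‖a‖ ^ 2) * (1 - ‖z‖ ^ 2) := by
  simp only [Complex.sq_norm, Complex.normSq_apply, Complex.sub_re, Complex.sub_im,
    Complex.mul_re, Complex.mul_im, Complex.conj_re, Complex.conj_im, Complex.one_re,
    Complex.one_im]
  ring

theorem norm_blaschkeFactor {a : ℂ} (ha0 : a ≠ 0) (z : ℂ) :
    ‖blaschkeFactor a z‖ = ‖a - z‖ / ‖1 - starRingEnd ℂ a * z‖ := by
  have : ‖a‖ ≠ 0 := norm_ne_zero_iff.2 ha0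
  simp [blaschkeFactor, div_self this]

theorem norm_blaschkeFactor_le_one {a z : ℂ} (ha0 : a ≠ 0) (ha : ‖a‖ < 1) (hz : ‖z‖ ≤ 1) :
    ‖blaschkeFactor a z‖ ≤ 1 := by
  rw [norm_blaschkeFactor ha0]
  refine div_le_one_of_le₀ ?_ (norm_nonneg _)
  have h := norm_one_sub_conj_mul_sq_sub a z
  have h1 : 0 ≤ (1 - ‖a‖ ^ 2) * (1 - ‖z‖ ^ 2) :=
    mul_nonneg (by nlinarith [norm_nonneg a]) (by nlinarith [norm_nonneg z])
  exact le_of_sq_le_sq (by linarith) (norm_nonneg _)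

theorem norm_blaschkeFactor_eq_one {a z : ℂ} (ha0 : a ≠ 0) (ha : ‖a‖ < 1) (hz : ‖z‖ = 1) :
    ‖blaschkeFactor a z‖ = 1 := by
  have hne := norm_ne_zero_iff.2 (one_sub_conj_mul_ne_zero ha hz.le)
  rw [norm_blaschkeFactor ha0, div_eq_one_iff_eq hne]
  have h := norm_one_sub_conj_mul_sq_sub a z
  rw [hz] at h
  exact (sq_eq_sq₀ (norm_nonneg _) (norm_nonneg _)).1 (by linarith)

theorem differentiableAt_blaschkeFactor {a z : ℂ} (ha : ‖a‖ < 1) (hz : ‖z‖ ≤ 1) :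
    DifferentiableAt ℂ (blaschkeFactor a) z := by
  unfold blaschkeFactor
  have := one_sub_conj_mul_ne_zero ha hz
  fun_prop (disch := assumption)

/-- The estimate which makes the Blaschke condition `∑ (1 - |αₙ|) < ∞` imply locally uniform
convergence of the product. -/
theorem norm_blaschkeFactor_sub_one_le {a z : ℂ} {r : ℝ} (ha0 : a ≠ 0) (ha : ‖a‖ < 1)
    (hr : r < 1) (hz : ‖z‖ ≤ r) :
    ‖blaschkeFactor a z - 1‖ ≤ 2 / (1 - r) * (1 - ‖a‖) := by
  have hne := one_sub_conj_mul_ne_zero ha (hz.trans hr.le)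
  have hr0 : 0 < 1 - r := by linarith
  have hconj : a * starRingEnd ℂ a = (‖a‖ : ℂ) * ‖a‖ := by
    rw [Complex.mul_conj, Complex.normSq_eq_norm_sq]; push_cast; ring
  have hid : blaschkeFactor a z - 1 =
      ((‖a‖ : ℂ) - 1) * ((1 + (‖a‖ : ℂ) / a * z) / (1 - starRingEnd ℂ a * z)) := by
    unfold blaschkeFactor
    generalize starRingEnd ℂ a = b at hne hconj
    rw [mul_comm] at hne
    field_simp
    linear_combination z * hconj
  have hna : ‖a‖ ≠ 0 := norm_ne_zero_iff.2 ha0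
  have h1 : ‖(‖a‖ : ℂ) - 1‖ = 1 - ‖a‖ := by
    rw [← Complex.ofReal_one, ← Complex.ofReal_sub, Complex.norm_real, Real.norm_eq_abs,
      abs_of_neg (by linarith)]
    ring
  have h2 : ‖1 + (‖a‖ : ℂ) / a * z‖ ≤ 2 := by
    refine (norm_add_le _ _).trans ?_
    have : ‖(‖a‖ : ℂ) / a * z‖ = ‖z‖ := by simp [div_self hna]
    rw [this, norm_one]
    linarith
  have h3 : 1 - r ≤ ‖1 - starRingEnd ℂ a * z‖ := by
    have h4 := norm_sub_norm_le (1 : ℂ) (starRingEnd ℂ a * z)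
    rw [norm_one, norm_mul, RCLike.norm_conj] at h4
    nlinarith [norm_nonneg a, norm_nonneg z]
  rw [hid, norm_mul, norm_div, h1, mul_comm]
  gcongr

/-! ### Blaschke products -/

theorem hasProdLocallyUniformlyOn_blaschkeFactor {ι : Type*} {α : ι → ℂ}
    (hα : ∀ n, α n ≠ 0 ∧ ‖α n‖ < 1) (hs : Summable fun n => 1 - ‖α n‖) :
    HasProdLocallyUniformlyOn (fun n => blaschkeFactor (α n))
      (fun z => ∏' n, blaschkeFactor (α n) z) (ball 0 1) := by
  apply hasProdLocallyUniformlyOn_of_forall_compact isOpen_ball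
  intro K hK hKc
  obtain ⟨r, hr, hKr⟩ := exists_pos_lt_subset_ball one_pos hKc.isClosed hK
  have h := Summable.hasProdUniformlyOn_one_add (f := fun n z => blaschkeFactor (α n) z - 1) hKc
    (hs.mul_left (2 / (1 - r)))
    (Eventually.of_forall fun n z hz => norm_blaschkeFactor_sub_one_le (hα n).1 (hα n).2 hr.2
      (mem_ball_zero_iff.1 (hKr hz)).le)
    (fun n z hz => ((differentiableAt_blaschkeFactor (hα n).2
      (mem_ball_zero_iff.1 (hK hz)).le).continuousAt.sub continuousAt_const).continuousWithinAt)
  simpa using h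

/-- A Blaschke product is holomorphic, and it is the pointwise limit of finite subproducts `Q S`,
which have larger modulus, are holomorphic up to the boundary, and are unimodular on the unit
circle. -/
theorem IsBlaschkeProduct.exists_finite_products {B : ℂ → ℂ} (hB : IsBlaschkeProduct B) :
    DifferentiableOn ℂ B (ball 0 1) ∧ ∃ (I : Set ℕ) (Q : Finset I → ℂ → ℂ),
      (∀ S, ∀ z ∈ closedBall (0 : ℂ) 1, DifferentiableAt ℂ (Q S) z) ∧
      (∀ S z, ‖z‖ = 1 → ‖Q S z‖ = 1) ∧
      (∀ S, ∀ z ∈ ball (0 : ℂ) 1, ‖B z‖ ≤ ‖Q S z‖) ∧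
      ∀ z ∈ ball (0 : ℂ) 1, Tendsto (fun S => Q S z) atTop (𝓝 (B z)) := by
  obtain ⟨c, m, I, α, hc, hα, hs, hP⟩ := hB
  have hprod := hasProdLocallyUniformlyOn_blaschkeFactor hα hs
  have hBeq : ∀ z ∈ ball (0 : ℂ) 1, B z = c * z ^ m * ∏' n, blaschkeFactor (α n) z := by
    intro z hz
    obtain ⟨P, hP1, hP2⟩ := hP z hz
    rw [hP2, (hprod.hasProd hz).unique hP1]
  have hfin : ∀ S : Finset I, ∀ z ∈ closedBall (0 : ℂ) 1,
      DifferentiableAt ℂ (fun z => ∏ n ∈ S, blaschkeFactor (α n) z) z := fun S z hz =>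
    DifferentiableAt.fun_finsetProd fun n _ =>
      differentiableAt_blaschkeFactor (hα n).2 (mem_closedBall_zero_iff.1 hz)
  refine ⟨?_, I, fun S z => c * z ^ m * ∏ n ∈ S, blaschkeFactor (α n) z, ?_, ?_, ?_, ?_⟩
  · have hd : DifferentiableOn ℂ (fun z => ∏' n, blaschkeFactor (α n) z) (ball 0 1) :=
      TendstoLocallyUniformlyOn.differentiableOn
        (hasProdLocallyUniformlyOn_iff_tendstoLocallyUniformlyOn.1 hprod)
        (Eventually.of_forall fun S z hz =>
          (hfin S z (ball_subset_closedBall hz)).differentiableWithinAt) isOpen_ball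
    refine DifferentiableOn.congr (DifferentiableOn.mul ?_ hd) hBeq
    fun_prop
  · intro S z hz
    exact DifferentiableAt.mul (by fun_prop) (hfin S z hz)
  · intro S z hz
    simp only [norm_mul, norm_pow, hc, hz, one_pow, one_mul, norm_prod]
    exact Finset.prod_eq_one fun n _ => norm_blaschkeFactor_eq_one (hα n).1 (hα n).2 hz
  · intro S z hz
    have hz' := (mem_ball_zero_iff.1 hz).le
    rw [hBeq z hz]
    simp only [norm_mul]
    gcongr
    refine le_of_tendsto (hprod.hasProd hz).norm ?_
    filter_upwards [eventually_ge_atTop S] with T hST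
    simp only [norm_prod]
    exact Finset.prod_le_prod_of_subset_of_le_one hST (fun _ _ => norm_nonneg _)
      fun n _ _ => norm_blaschkeFactor_le_one (hα n).1 (hα n).2 hz'
  · intro z hz
    rw [hBeq z hz]
    exact (hprod.hasProd hz).const_mul _

theorem IsBlaschkeProduct.differentiableOn {B : ℂ → ℂ} (hB : IsBlaschkeProduct B) :
    DifferentiableOn ℂ B (ball 0 1) :=
  hB.exists_finite_products.1

theorem IsBlaschkeProduct.norm_le_one {B : ℂ → ℂ} (hB : IsBlaschkeProduct B) {z : ℂ}
    (hz : z ∈ ball (0 : ℂ) 1) : ‖B z‖ ≤ 1 := by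
  obtain ⟨-, I, Q, hd, h1, hle, -⟩ := hB.exists_finite_products
  refine (hle ∅ z hz).trans (Complex.norm_le_of_forall_mem_frontier_norm_le
    (isBounded_ball (x := (0 : ℂ)) (r := 1)) (f := Q ∅) (DifferentiableOn.diffContOnCl fun w hw =>
      (hd ∅ w (closure_ball_subset_closedBall hw)).differentiableWithinAt)
    (fun w hw => ?_) (subset_closure hz))
  rw [frontier_ball _ one_ne_zero, mem_sphere_zero_iff_norm] at hw
  exact (h1 ∅ w hw).le

/-! ### The maximum principle -/

/-- The bound `-log |f| ≥ n / (n + 1) * (-log |B|)` propagates from the boundary of the set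
`{|B| > ρ}` inside the disc to the whole of that set. -/
theorem IsBlaschkeProduct.norm_pow_succ_le {B f : ℂ → ℂ} (hB : IsBlaschkeProduct B)
    (hf : DifferentiableOn ℂ f (ball 0 1)) (hf1 : ∀ z ∈ ball (0 : ℂ) 1, ‖f z‖ ≤ 1)
    {n : ℕ} {ρ : ℝ} (hρ : 0 < ρ)
    (hfρ : ∀ z ∈ ball (0 : ℂ) 1, ‖B z‖ = ρ → ‖f z‖ ^ (n + 1) ≤ ρ ^ n)
    {z₀ : ℂ} (hz₀ : z₀ ∈ ball (0 : ℂ) 1) (hBz₀ : ρ ≤ ‖B z₀‖) :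
    ‖f z₀‖ ^ (n + 1) ≤ ‖B z₀‖ ^ n := by
  obtain ⟨hBd, I, Q, hQd, hQ1, hBQ, hQB⟩ := hB.exists_finite_products
  rcases hBz₀.eq_or_lt with heq | hlt
  · rw [← heq]
    exact hfρ z₀ hz₀ heq.symm
  refine ge_of_tendsto (((hQB z₀ hz₀).norm).pow n) (Eventually.of_forall fun S => ?_)
  have key : ∀ c : ℝ, 0 < c → c < 1 → ‖f z₀‖ ^ (n + 1) * c ^ n ≤ ‖Q S z₀‖ ^ n := by
    intro c hc0 hc1
    -- since `|Q S| = 1` on the circle, `|Q S| > c` on `r ≤ |z| < 1` for some `r < 1`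
    have hclosed : IsClosed (closedBall (0 : ℂ) 1 ∩ {z | ‖Q S z‖ ≤ c}) :=
      ContinuousOn.preimage_isClosed_of_isClosed
        (f := fun z => ‖Q S z‖) (t := Set.Iic c)
        (fun z hz => (hQd S z hz).continuousAt.norm.continuousWithinAt)
        isClosed_closedBall isClosed_Iic
    obtain ⟨r₁, hr₁, hsub⟩ := exists_pos_lt_subset_ball one_pos hclosed (x := (0 : ℂ)) (by
      rintro z ⟨hz, hzc⟩
      rw [mem_closedBall_zero_iff] at hz
      refine mem_ball_zero_iff.2 (hz.lt_of_ne fun h => ?_)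
      rw [Set.mem_ofPred_eq, hQ1 S z h] at hzc
      linarith)
    rw [mem_ball_zero_iff] at hz₀
    obtain ⟨r, hrmax, hr1⟩ := exists_between (max_lt hr₁.2 hz₀)
    obtain ⟨hrr₁, hrz₀⟩ := max_lt_iff.1 hrmax
    have hcl : closedBall (0 : ℂ) r ⊆ ball 0 1 := closedBall_subset_ball hr1
    let U : Set ℂ := ball 0 r ∩ {z | ρ < ‖B z‖}
    have hUcl : closure U ⊆ closedBall 0 r :=
      (closure_mono Set.inter_subset_left).trans closure_ball_subset_closedBall
    have hclosedB : IsClosed (closedBall (0 : ℂ) r ∩ {z | ρ ≤ ‖B z‖}) :=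
      ContinuousOn.preimage_isClosed_of_isClosed
        (f := fun z => ‖B z‖) (t := Set.Ici ρ) ((hBd.continuousOn.mono hcl).norm)
        isClosed_closedBall isClosed_Ici
    have hUρ : ∀ z ∈ closure U, ρ ≤ ‖B z‖ := fun z hz =>
      (closure_minimal (Set.inter_subset_inter ball_subset_closedBall fun w (hw : ρ < ‖B w‖) =>
        hw.le) hclosedB hz).2
    have hUo : IsOpen U := (hBd.continuousOn.norm.mono
      (ball_subset_closedBall.trans hcl)).isOpen_inter_preimage isOpen_ball isOpen_Ioi
    have hQ0 : ∀ z ∈ closure U, Q S z ≠ 0 := fun z hz h => by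
      have h1 := hBQ S z (hcl (hUcl hz))
      rw [h, norm_zero] at h1
      linarith [hUρ z hz]
    have hd : DiffContOnCl ℂ (fun z => f z ^ (n + 1) / Q S z ^ n) U := by
      refine DifferentiableOn.diffContOnCl fun z hz => DifferentiableAt.differentiableWithinAt ?_
      have hz1 := hcl (hUcl hz)
      exact ((hf.differentiableAt (isOpen_ball.mem_nhds hz1)).fun_pow _).fun_div
        ((hQd S z (ball_subset_closedBall hz1)).fun_pow _) (pow_ne_zero _ (hQ0 z hz))
    have hz₀U : z₀ ∈ U := ⟨mem_ball_zero_iff.2 hrz₀, hlt⟩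
    have hmax := Complex.norm_le_of_forall_mem_frontier_norm_le
      (isBounded_ball.subset Set.inter_subset_left) hd (C := 1 / c ^ n) (fun z hz => ?_)
      (subset_closure hz₀U)
    · have hQpos : 0 < ‖Q S z₀‖ := norm_pos_iff.2 (hQ0 z₀ (subset_closure hz₀U))
      rw [norm_div, norm_pow, norm_pow, div_le_div_iff₀ (by positivity) (by positivity)] at hmax
      linarith
    · have hzcl := frontier_subset_closure hz
      have hz1 := hcl (hUcl hzcl)
      have hQpos : 0 < ‖Q S z‖ := norm_pos_iff.2 (hQ0 z hzcl)
      have hzU : z ∉ U := by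
        rw [hUo.frontier_eq] at hz
        exact hz.2
      rw [norm_div, norm_pow, norm_pow, div_le_div_iff₀ (by positivity) (by positivity), one_mul]
      have hBle := hBQ S z hz1
      have hρle := hUρ z hzcl
      by_cases hzr : ‖z‖ < r
      · have hBρ : ‖B z‖ = ρ :=
          le_antisymm (not_lt.1 fun h => hzU ⟨mem_ball_zero_iff.2 hzr, h⟩) hρle
        calc ‖f z‖ ^ (n + 1) * c ^ n ≤ ρ ^ n * 1 :=
              mul_le_mul (hfρ z hz1 hBρ) (pow_le_one₀ hc0.le hc1.le) (by positivity)
                (by positivity)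
          _ ≤ ‖Q S z‖ ^ n := by
              rw [mul_one]
              exact pow_le_pow_left₀ hρ.le (hρle.trans hBle) n
      · have hcQ : c ≤ ‖Q S z‖ := by
          by_contra! h
          have := mem_ball_zero_iff.1 (hsub ⟨ball_subset_closedBall hz1, h.le⟩)
          linarith
        calc ‖f z‖ ^ (n + 1) * c ^ n ≤ 1 * c ^ n := by
              gcongr
              exact pow_le_one₀ (norm_nonneg _) (hf1 z hz1)
          _ ≤ ‖Q S z‖ ^ n := by
              rw [one_mul]
              exact pow_le_pow_left₀ hc0.le hcQ n
  have hlim : Tendsto (fun c : ℝ => ‖f z₀‖ ^ (n + 1) * c ^ n) (𝓝[<] 1)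
      (𝓝 (‖f z₀‖ ^ (n + 1) * 1 ^ n)) :=
    Tendsto.mono_left (Continuous.tendsto (by fun_prop) 1) nhdsWithin_le_nhds
  rw [one_pow, mul_one] at hlim
  refine le_of_tendsto hlim ?_
  filter_upwards [Ioo_mem_nhdsLT (zero_lt_one' ℝ)] with c hc using key c hc.1 hc.2

/-! ### Stability of the level sets -/

theorem norm_lt_of_supNormDisc_lt {f : ℂ → ℂ} {η : ℝ} (h : supNormDisc f < ENNReal.ofReal η)
    {z : ℂ} (hz : z ∈ ball (0 : ℂ) 1) : ‖f z‖ < η := by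
  have h1 : ‖f z‖ₑ < ENNReal.ofReal η :=
    lt_of_le_of_lt (le_iSup₂ (f := fun z (_ : z ∈ ball (0 : ℂ) 1) => ‖f z‖ₑ) z hz) h
  rw [← ofReal_norm] at h1
  exact (ENNReal.ofReal_lt_ofReal_iff_of_nonneg (norm_nonneg _)).1 h1

theorem levelSet_thetaOf_subset_of_norm_sub_le {B B₁ : ℂ → ℂ} (hB : IsBlaschkeProduct B)
    (hB₁ : IsBlaschkeProduct B₁) {Δ ρ η : ℝ} {n : ℕ} (hn : n ≠ 0)
    (hpow : ∀ t, 0 < t → thetaOf t ^ n ≤ thetaOf (t + Δ) ^ (n + 1))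
    (hΔ : 0 < Δ) (hρ : 0 < ρ) (hηΔ : ρ + η ≤ thetaOf Δ) (hηρ : (ρ + η) ^ (n + 1) ≤ ρ ^ n)
    (hsub : ∀ z ∈ ball (0 : ℂ) 1, ‖B₁ z - B z‖ ≤ η) (t : ℝ) :
    levelSet B (thetaOf t) ⊆ levelSet B₁ (thetaOf (t + Δ)) := by
  rcases le_or_gt t 0 with ht | ht
  · rw [levelSet_thetaOf_eq_empty B ht]
    exact Set.empty_subset _
  have hnorm : ∀ z ∈ ball (0 : ℂ) 1, ‖B₁ z‖ ≤ ‖B z‖ + η := fun z hz => by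
    linarith [norm_sub_norm_le (B₁ z) (B z), hsub z hz]
  rintro z ⟨hz, hzt⟩
  refine ⟨hz, ?_⟩
  rcases lt_or_ge ‖B z‖ ρ with hzρ | hzρ
  · have h1 : thetaOf Δ ≤ thetaOf (t + Δ) := thetaOf_mono (by linarith)
    linarith [hnorm z hz]
  · have h1 : ‖B₁ z‖ ^ (n + 1) ≤ ‖B z‖ ^ n :=
      hB.norm_pow_succ_le hB₁.differentiableOn (fun w hw => hB₁.norm_le_one hw) hρ
        (fun w hw hwρ => (pow_le_pow_left₀ (norm_nonneg _)
          (hwρ ▸ hnorm w hw) (n + 1)).trans hηρ) hz hzρ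
    have h2 : ‖B z‖ ^ n < thetaOf t ^ n := pow_lt_pow_left₀ hzt (norm_nonneg _) hn
    exact lt_of_pow_lt_pow_left₀ (n + 1) (thetaOf_pos (by linarith)).le
      ((h1.trans_lt h2).trans_le (hpow t ht))

end

theorem theoremB {F : Type*} [Field F] (B : ℂ → ℂ)
    (hB : IsBlaschkeProduct B) (hB' : StrongPropertyB B) :
    ∀ ε : ℝ, 0 < ε → ∃ η : ℝ, 0 < η ∧ η < 1 ∧
      ∀ B₁ : ℂ → ℂ, IsBlaschkeProduct B₁ → StrongPropertyB B₁ →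
        supNormDisc (fun z => B₁ z - B z) < ENNReal.ofReal η →
        PersistenceModule.interleavingDist (inducedModule F B) (inducedModule F B₁) <
          ENNReal.ofReal ε := by
  intro ε hε
  have hΔ : 0 < ε / 2 := by positivity
  obtain ⟨n, hn, hpow⟩ := exists_forall_thetaOf_pow_le hΔ
  -- any level strictly between `0` and `θ(ε / 2)` separates the two regimes
  set ρ := thetaOf (ε / 4)
  have hρ : 0 < ρ := thetaOf_pos (by positivity)
  have hρ1 : ρ < 1 := thetaOf_lt_one _
  have hρΔ : ρ < thetaOf (ε / 2) := thetaOf_strictMono (by linarith)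
  have hcont : Filter.Tendsto (fun η : ℝ => (ρ + η) ^ (n + 1)) (nhdsWithin 0 (Set.Ioi 0))
      (nhds ((ρ + 0) ^ (n + 1))) :=
    Filter.Tendsto.mono_left (Continuous.tendsto (by fun_prop) 0) nhdsWithin_le_nhds
  have hlt : (ρ + 0) ^ (n + 1) < ρ ^ n := by
    rw [add_zero]
    exact pow_lt_pow_right_of_lt_one₀ hρ hρ1 n.lt_succ_self
  obtain ⟨η, hηρ, hη⟩ := ((hcont.eventually_lt_const hlt).and (Ioo_mem_nhdsGT
    (show (0 : ℝ) < min 1 (thetaOf (ε / 2) - ρ) from lt_min one_pos (by linarith)))).exists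
  obtain ⟨hη1, hηΔ⟩ := lt_min_iff.1 hη.2
  refine ⟨η, hη.1, hη1, fun B₁ hB₁ _ hsup => ?_⟩
  have hsub : ∀ z ∈ Metric.ball (0 : ℂ) 1, ‖B₁ z - B z‖ ≤ η := fun z hz =>
    (norm_lt_of_supNormDisc_lt hsup hz).le
  have hint := interleaved_inducedModule_of_levelSet_subset F hΔ
    (levelSet_thetaOf_subset_of_norm_sub_le hB hB₁ hn hpow hΔ hρ (by linarith) hηρ.le hsub)
    (levelSet_thetaOf_subset_of_norm_sub_le hB₁ hB hn hpow hΔ hρ (by linarith) hηρ.le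
      fun z hz => by rw [norm_sub_rev]; exact hsub z hz)
  exact (iInf₂_le (ε / 2) hint).trans_lt ((ENNReal.ofReal_lt_ofReal_iff hε).2 (by linarith))
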